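/- Let $V$ be a finite-dimensional real vector space, let $P=\mathbb{P}(V)$ be its real projective space with the quotient topology, let $\pi\colon V\setminus\{0\}\to P$ be the projection, and let $P^*=\mathbb{P}(V^*)$ be the dual projective space. The two line segments joining distinct points $\pi(u),\pi(v)$ are $\{\pi(\lambda u+\mu v): \lambda\mu\ge 0,\ (\lambda,\mu)\ne(0,0)\}$ and $\{\pi(\lambda u+\mu v): \lambda\mu\le 0,\ (\lambda,\mu)\neq(0,0)\}$. A subset of $P$ is convex if any two distinct points of it are joined by a line segment contained in it, and some projective hyperplane is disjoint from it. A convex set $A$ is irreducible if $A=B\cap B'$ with $B,B'$ convex implies $A=B$ or $A=B'$. A multi-convex set is the intersection of a nonempty family of convex sets. For a subset $C$ of a projective space, a component of $C$ is a maximal convex subset of $C$, and a co-component of $C$ is a minimal convex set containing $C$; write $\mathrm{comp}(C)$ and $\mathrm{cocomp}(C)$ for the sets of components and co-components. A point $q=[f]\in P^*$ corresponds to the set $\delta(q)=\{\pi(v): f(v)\neq 0\}$, the complement of a projective hyperplane of $P$. For $S\subseteq P$, let $\Phi(S)\subseteq P^*$ be the set of all $q$ such that $\delta(q)$ is an irreducible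 convex set containing $S$. Let $C$ be a nonempty multi-convex set in $P$ that is open or closed. Then $N\mapsto\Phi(N)$ is a bijection from $\mathrm{comp}(C)$ onto $\mathrm{cocomp}(\Phi(C))$, and it is also a bijection from $\mathrm{cocomp}(C)$ onto $\mathrm{comp}(\Phi(C))$. -/

import Mathlib

open scoped LinearAlgebra.Projectivization

namespace MultiConvex

/-- The topology of the real projective space of a real topological vector space `V`: the quotient
topology of the subspace topology on the nonzero vectors of `V`. -/
instance projTopology (V : Type*) [AddCommGroup V] [Module ℝ V] [TopologicalSpace V] :
    TopologicalSpace (ℙ ℝ V) :=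
  inferInstanceAs (TopologicalSpace (Quotient (projectivizationSetoid ℝ V)))

section

variable {V : Type*} [AddCommGroup V] [Module ℝ V]

/-- The points `π(a u + b v)` with `a b ≥ 0` and `a u + b v ≠ 0`. For linearly independent `u`, `v`,
`a u + b v ≠ 0` means that `a ≠ 0` or `b ≠ 0`. -/
def segNonneg (u v : V) : Set (ℙ ℝ V) :=
  {x | ∃ (a b : ℝ) (h : a • u + b • v ≠ 0),
    0 ≤ a * b ∧ x = Projectivization.mk ℝ (a • u + b • v) h}

/-- The points `π(a u + b v)` with `a b ≤ 0` and `a u + b v ≠ 0`. -/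
def segNonpos (u v : V) : Set (ℙ ℝ V) :=
  {x | ∃ (a b : ℝ) (h : a • u + b • v ≠ 0),
    a * b ≤ 0 ∧ x = Projectivization.mk ℝ (a • u + b • v) h}

/-- `T` is one of the two projective line segments joining the distinct points `p` and `q`. -/
def IsSegment (p q : ℙ ℝ V) (T : Set (ℙ ℝ V)) : Prop :=
  p ≠ q ∧ ∃ (u v : V) (hu : u ≠ 0) (hv : v ≠ 0),
    Projectivization.mk ℝ u hu = p ∧ Projectivization.mk ℝ v hv = q ∧
      (T = segNonneg u v ∨ T = segNonpos u v)

/-- Any two distinct points of `S` are joined by a line segment contained in `S`. -/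
def IsSemiconvex (S : Set (ℙ ℝ V)) : Prop :=
  ∀ p ∈ S, ∀ q ∈ S, p ≠ q → ∃ T, IsSegment p q T ∧ T ⊆ S

/-- The projective hyperplane of `ℙ ℝ V` that corresponds to a point `q = [f]` of the dual projective
space: the zero locus of the nonzero linear functional `f`. -/
def hyperplane (q : ℙ ℝ (Module.Dual ℝ V)) : Set (ℙ ℝ V) :=
  {p | ∀ f ∈ q.submodule, ∀ v ∈ p.submodule, f v = 0}

theorem mk_mem_hyperplane_mk {f : Module.Dual ℝ V} (hf : f ≠ 0) {v : V} (hv : v ≠ 0) :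
    Projectivization.mk ℝ v hv ∈ hyperplane (Projectivization.mk ℝ f hf) ↔ f v = 0 := by
  constructor
  · intro h
    exact h f (by simp) v
      (by simp)
  · intro h g hg w hw
    rw [Projectivization.submodule_mk, Submodule.mem_span_singleton] at hg hw
    obtain ⟨a, rfl⟩ := hg
    obtain ⟨b, rfl⟩ := hw
    simp [h]

/-- A projective convex set: semiconvex and avoided by some projective hyperplane. -/
def IsProjConvex (S : Set (ℙ ℝ V)) : Prop :=
  IsSemiconvex S ∧ ∃ q : ℙ ℝ (Module.Dual ℝ V), Disjoint (hyperplane q) S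

/-- A convex set that is not the intersection of two strictly greater convex sets. -/
def IsIrreducibleConvex (A : Set (ℙ ℝ V)) : Prop :=
  IsProjConvex A ∧
    ∀ B C : Set (ℙ ℝ V), IsProjConvex B → IsProjConvex C → A = B ∩ C → A = B ∨ A = C

/-- The subset `δ(q)` of `ℙ ℝ V` corresponding to a point `q` of the dual projective space: the
complement of the hyperplane corresponding to `q`. -/
def delta (q : ℙ ℝ (Module.Dual ℝ V)) : Set (ℙ ℝ V) :=
  (hyperplane q)ᶜ

/-- `Φ(S)`: the points of the dual projective space that correspond to the irreducible convex sets
containing `S`. -/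
def Phi (S : Set (ℙ ℝ V)) : Set (ℙ ℝ (Module.Dual ℝ V)) :=
  {q | ∃ A : Set (ℙ ℝ V), IsIrreducibleConvex A ∧ S ⊆ A ∧ A = delta q}

/-- A multi-convex set: the intersection of a nonempty family of convex sets. -/
def IsMultiConvex (C : Set (ℙ ℝ V)) : Prop :=
  ∃ F : Set (Set (ℙ ℝ V)), F.Nonempty ∧ (∀ N ∈ F, IsProjConvex N) ∧ C = ⋂₀ F

/-- The components of `C`: the maximal convex subsets of `C`. -/
def comp (C : Set (ℙ ℝ V)) : Set (Set (ℙ ℝ V)) :=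
  {N | Maximal (fun M => IsProjConvex M ∧ M ⊆ C) N}

/-- The co-components of `C`: the minimal convex sets containing `C`. -/
def cocomp (C : Set (ℙ ℝ V)) : Set (Set (ℙ ℝ V)) :=
  {N | Minimal (fun M => IsProjConvex M ∧ C ⊆ M) N}

end

end MultiConvex

/-! Everything is read off on cones of representatives. The complement of a hyperplane is a maximal
convex set, hence irreducible, so the cone of `Φ(C)` is the set of functionals with no zero on the
cone of `C` (`coneOf_Phi`).

A co-component of `C` is the convex hull of `C` in an affine chart `f ≠ 0` containing it (`hull`). A
component is a sign class: two points of `C` lie in the same one if, after rescaling, every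
functional avoiding `C` has the same sign at both (`signCone`). The same descriptions apply to
`Φ(C)`, with evaluations at points of `C` as the functionals.

Duality exchanges the two. A functional `g` avoids the hull in the chart of `f` exactly when `f * g`
has constant sign on the cone of `C`, so `Φ` of that hull is the sign class of `f` (`Phi_hull`).
Conversely `Φ` of the sign class of `u` is the hull of `Φ(C)` in the chart given by evaluation at
`u` (`Phi_proj_signCone`). This second half rests on Hahn-Banach, used once in the dual and once in
the space itself, where it shows that `C` is cut out by the hyperplanes that miss it. Polarity
exchanges open cones with cones closed away from zero, so separation is available on both sides. -/

namespace MultiConvex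

/-! ### Separating a line from half of a symmetric cone. -/

section Separation

variable {W : Type*} [AddCommGroup W] [Module ℝ W] [FiniteDimensional ℝ W]
  [TopologicalSpace W] [IsTopologicalAddGroup W] [ContinuousSMul ℝ W]

/-- In finite dimension the convex hull of a compact set is compact (by Carathéodory). -/
theorem isCompact_convexHull {s : Set W} (hs : IsCompact s) : IsCompact (convexHull ℝ s) := by
  -- Carathéodory: affinely independent points number at most `finrank + 1`, hence the range up to
  -- `finrank + 2`.
  have key : convexHull ℝ s = ⋃ k ∈ Finset.range (Module.finrank ℝ W + 2),
      (fun p : (Fin k → ℝ) × (Fin k → W) ↦ ∑ i, p.1 i • p.2 i) ''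
        (stdSimplex ℝ (Fin k) ×ˢ Set.pi Set.univ fun _ ↦ s) := by
    ext x
    simp only [Set.mem_iUnion, Set.mem_image, Prod.exists, Set.mem_prod, Set.mem_univ_pi]
    constructor
    · intro hx
      obtain ⟨ι, _, z, w, hz, hind, hw, hw1, rfl⟩ := eq_pos_convex_span_of_mem_convexHull hx
      let e := Fintype.equivFin ι
      refine ⟨Fintype.card ι, ?_, w ∘ e.symm, z ∘ e.symm, ⟨⟨fun i ↦ (hw _).le, ?_⟩, ?_⟩, ?_⟩
      · have := hind.card_le_finrank_succ
        have h2 := Submodule.finrank_le (vectorSpan ℝ (Set.range z))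
        simp only [Finset.mem_range]
        omega
      · rw [← hw1]
        exact Equiv.sum_comp e.symm w
      · exact fun i ↦ hz ⟨_, rfl⟩
      · exact Equiv.sum_comp e.symm (fun i ↦ w i • z i)
    · rintro ⟨k, -, w, z, ⟨⟨hw, hw1⟩, hz⟩, rfl⟩
      exact (convex_convexHull ℝ s).sum_mem (fun i _ ↦ hw i) hw1
        fun i _ ↦ subset_convexHull ℝ s (hz i)
  rw [key]
  refine (Finset.range _).isCompact_biUnion fun k _ ↦ ?_
  refine ((isCompact_stdSimplex ℝ (Fin k)).prod (isCompact_univ_pi fun _ ↦ hs)).image ?_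
  fun_prop

variable [T2Space W]

theorem locallyConvexSpace_of_finiteDimensional : LocallyConvexSpace ℝ W := by
  let e : W ≃L[ℝ] EuclideanSpace ℝ (Fin (Module.finrank ℝ W)) :=
    ContinuousLinearEquiv.ofFinrankEq (by simp)
  exact Topology.IsInducing.locallyConvexSpace (f := e.toLinearEquiv.toLinearMap)
    e.toHomeomorph.isInducing

variable (W) in
/-- A finite-dimensional space contains a compact set that meets every ray and avoids zero. -/
theorem exists_compact_section : ∃ B : Set W, IsCompact B ∧ (0 : W) ∉ B ∧
    ∀ v : W, v ≠ 0 → ∃ c : ℝ, 0 < c ∧ c • v ∈ B := by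
  let e : W ≃L[ℝ] EuclideanSpace ℝ (Fin (Module.finrank ℝ W)) :=
    ContinuousLinearEquiv.ofFinrankEq (by simp)
  refine ⟨e ⁻¹' Metric.sphere 0 1, ?_, by simp, fun v hv ↦ ⟨‖e v‖⁻¹, ?_, ?_⟩⟩
  · exact e.toHomeomorph.isCompact_preimage.2 (isCompact_sphere _ _)
  · have : e v ≠ 0 := by simpa using hv
    positivity
  · have : ‖e v‖ ≠ 0 := by simpa using hv
    simp [norm_smul, this]

/-- Half of a symmetric cone, cut out by a functional that does not vanish on it, is separated from
any line that misses its convex hull, provided the cone is open or closed away from zero. -/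
theorem exists_dual_pos {K : Set W} (hK : ∀ v ∈ K, ∀ c : ℝ, c ≠ 0 → c • v ∈ K) (h0 : (0 : W) ∉ K)
    (htop : IsOpen K ∨ IsClosed (insert 0 K)) {f : Module.Dual ℝ W} (hf : ∀ v ∈ K, f v ≠ 0)
    {p : W} (hp : ∀ c : ℝ, c • p ∉ convexHull ℝ (K ∩ {v | 0 < f v})) :
    ∃ g : Module.Dual ℝ W, g p = 0 ∧ ∀ v ∈ K, 0 < f v → 0 < g v := by
  have := locallyConvexSpace_of_finiteDimensional (W := W)
  have hfc : Continuous f := f.continuous_of_finiteDimensional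
  rcases htop with hop | hcl
  · have ho : IsOpen (convexHull ℝ (K ∩ {v | 0 < f v})) :=
      (hop.inter (isOpen_lt continuous_const hfc)).convexHull
    obtain ⟨g, c, hg, hc⟩ := geometric_hahn_banach_open (convex_convexHull ℝ _) ho
      (Submodule.convex (ℝ ∙ p)) (Set.disjoint_left.2 fun x hx hx' ↦ by
        obtain ⟨a, rfl⟩ := Submodule.mem_span_singleton.1 hx'
        exact hp a hx)
    -- A functional bounded below on a line through zero vanishes on it; the multiple chosen here
    -- would take the value `c - 1`, below the bound `c`.
    have hgp : g p = 0 := by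
      by_contra h
      have := hc (((c - 1) / g p) • p) (Submodule.smul_mem _ _ (Submodule.mem_span_singleton_self p))
      rw [map_smul, smul_eq_mul, div_mul_cancel₀ _ h] at this
      linarith
    have hc0 : c ≤ 0 := by simpa using hc 0 (Submodule.zero_mem _)
    refine ⟨-(g : W →ₗ[ℝ] ℝ), by simpa using hgp, fun v hv hfv ↦ ?_⟩
    have := hg v (subset_convexHull ℝ _ ⟨hv, hfv⟩)
    simp only [LinearMap.neg_apply, ContinuousLinearMap.coe_coe]
    linarith
  · by_cases hfp : f p = 0
    · exact ⟨f, hfp, fun _ _ h ↦ h⟩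
    obtain ⟨B, hB, hB0, hBs⟩ := exists_compact_section W
    have hKB : K ∩ B = insert 0 K ∩ B := by
      ext v
      constructor
      · exact fun h ↦ ⟨Or.inr h.1, h.2⟩
      · rintro ⟨rfl | h, h'⟩
        · exact absurd h' hB0
        · exact ⟨h, h'⟩
    -- Rescaling to `f = 1` turns the closed cone into a compact slice, whose convex hull can be
    -- strictly separated from the point of the line through `p` with `f = 1`.
    have hcomp : IsCompact ((fun v ↦ (f v)⁻¹ • v) '' (K ∩ B)) := by
      refine IsCompact.image_of_continuousOn (hKB ▸ hB.inter_left hcl) ?_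
      exact (hfc.continuousOn.inv₀ fun v hv ↦ hf v hv.1).smul continuousOn_id
    set S := (fun v ↦ (f v)⁻¹ • v) '' (K ∩ B) with hS
    have hSK : S ⊆ K ∩ {v | 0 < f v} := by
      rintro _ ⟨v, ⟨hv, -⟩, rfl⟩
      exact ⟨hK v hv _ (inv_ne_zero (hf v hv)), by simp [inv_mul_cancel₀ (hf v hv)]⟩
    have hp' : (f p)⁻¹ • p ∉ convexHull ℝ S := fun h ↦ hp _ (convexHull_mono hSK h)
    obtain ⟨g, c, hgp, hgS⟩ := geometric_hahn_banach_point_closed (convex_convexHull ℝ S)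
      (isCompact_convexHull hcomp).isClosed hp'
    rw [map_smul, smul_eq_mul] at hgp
    -- On `f = 1` the constant `(f p)⁻¹ * g p` is the value of `g` at the normalized `p`;
    -- subtracting that multiple of `f` makes the separating affine function linear.
    refine ⟨(g : W →ₗ[ℝ] ℝ) - ((f p)⁻¹ * g p) • f, ?_, fun v hv hfv ↦ ?_⟩
    · simp only [LinearMap.sub_apply, ContinuousLinearMap.coe_coe, LinearMap.smul_apply, smul_eq_mul]
      rw [mul_right_comm, inv_mul_cancel₀ hfp, one_mul, sub_self]
    · obtain ⟨a, ha, hav⟩ := hBs v (fun h ↦ h0 (h ▸ hv))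
      have := hgS _ (subset_convexHull ℝ S ⟨a • v, ⟨hK v hv a ha.ne', hav⟩, rfl⟩)
      have e : (f (a • v))⁻¹ • a • v = (f v)⁻¹ • v := by
        rw [map_smul, smul_smul, smul_eq_mul]
        congr 1
        field_simp
      beta_reduce at this
      rw [e, map_smul, smul_eq_mul] at this
      have h3 : (f p)⁻¹ * g p < (f v)⁻¹ * g v := hgp.trans this
      have h4 := mul_lt_mul_of_pos_right h3 hfv
      rw [mul_right_comm (f v)⁻¹, inv_mul_cancel₀ hfv.ne', one_mul] at h4
      simpa using h4

end Separation

/-! ### Topology of the polar cone. -/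

section Polar

variable {W : Type*} [AddCommGroup W] [Module ℝ W]

/-- The functionals without zero on `K`. -/
def avoiding (K : Set W) : Set (Module.Dual ℝ W) :=
  {f | f ≠ 0 ∧ ∀ v ∈ K, f v ≠ 0}

/-- The topology of pointwise convergence on the algebraic dual. -/
abbrev dualTopology (W : Type*) [AddCommGroup W] [Module ℝ W] :
    TopologicalSpace (Module.Dual ℝ W) :=
  TopologicalSpace.induced (LinearMap.ltoFun ℝ W ℝ ℝ) inferInstance

attribute [local instance] dualTopology

theorem isTopologicalAddGroup_dual : IsTopologicalAddGroup (Module.Dual ℝ W) :=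
  topologicalAddGroup_induced (LinearMap.ltoFun ℝ W ℝ ℝ)

theorem continuousSMul_dual : ContinuousSMul ℝ (Module.Dual ℝ W) :=
  continuousSMul_induced (LinearMap.ltoFun ℝ W ℝ ℝ)

theorem continuous_dual_apply (v : W) : Continuous fun f : Module.Dual ℝ W ↦ f v :=
  (continuous_apply v).comp continuous_induced_dom

theorem t2Space_dual : T2Space (Module.Dual ℝ W) :=
  T2Space.of_injective_continuous (f := LinearMap.ltoFun ℝ W ℝ ℝ) DFunLike.coe_injective
    continuous_induced_dom

variable [TopologicalSpace W] [IsTopologicalAddGroup W] [ContinuousSMul ℝ W]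

/-- If `f ≠ 0` vanishes at `v ∈ K` and `f w ≠ 0`, then for `g` near `f` the vector `v - (g v / g w)
• w` is a zero of `g` close to `v`, hence in the open set `K`. So `g` does not avoid `K` either. -/
theorem isClosed_insert_zero_avoiding {K : Set W} (hK : IsOpen K) :
    IsClosed (insert 0 (avoiding K)) := by
  have := t2Space_dual (W := W)
  rw [← isOpen_compl_iff, isOpen_iff_mem_nhds]
  intro f hf
  simp only [avoiding, Set.mem_compl_iff, Set.mem_insert_iff, Set.mem_ofPred_eq, not_or, not_and,
    not_forall, not_not] at hf
  obtain ⟨hf0, hf⟩ := hf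
  obtain ⟨v, hv, hfv⟩ := hf hf0
  obtain ⟨w, hw⟩ : ∃ w, f w ≠ 0 := by
    by_contra! h
    exact hf0 (LinearMap.ext h)
  have hc : ContinuousAt (fun g : Module.Dual ℝ W ↦ v - (g v / g w) • w) f :=
    continuousAt_const.sub (((continuous_dual_apply v).continuousAt.div
      (continuous_dual_apply w).continuousAt hw).smul continuousAt_const)
  have h1 := hc.preimage_mem_nhds (by simpa [hfv] using hK.mem_nhds hv)
  have h2 := (continuous_dual_apply w).continuousAt.eventually_ne hw
  filter_upwards [h1, h2] with g hg1 hg2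
  rintro (rfl | ⟨-, hg⟩)
  · simp at hg2
  · exact hg _ hg1 (by simp [div_mul_cancel₀ _ hg2])

/-- By homogeneity it suffices not to vanish on a compact section of `K`, which is an open condition
because evaluation is jointly continuous in finite dimension. -/
theorem isOpen_avoiding [FiniteDimensional ℝ W] [T2Space W] {K : Set W} (hne : K.Nonempty)
    (hK : ∀ v ∈ K, ∀ c : ℝ, c ≠ 0 → c • v ∈ K) (h0 : (0 : W) ∉ K)
    (hcl : IsClosed (insert 0 K)) : IsOpen (avoiding K) := by
  obtain ⟨B, hB, hB0, hBs⟩ := exists_compact_section W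
  have hKB : insert 0 K ∩ B ⊆ K := by
    rintro v ⟨rfl | h, h'⟩
    · exact absurd h' hB0
    · exact h
  have hcont : Continuous fun p : Module.Dual ℝ W × W ↦ p.1 p.2 := by
    let b := Module.finBasis ℝ W
    have : (fun p : Module.Dual ℝ W × W ↦ p.1 p.2) =
        fun p ↦ ∑ i, b.coord i p.2 * p.1 (b i) := by
      ext p
      conv_lhs => rw [← b.sum_repr p.2, map_sum]
      simp only [map_smul, smul_eq_mul, Module.Basis.coord_apply]
    rw [this]
    exact continuous_finsetSum _ fun i _ ↦
      ((b.coord i).continuous_of_finiteDimensional.comp continuous_snd).mul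
        ((continuous_dual_apply (b i)).comp continuous_fst)
  rw [isOpen_iff_mem_nhds]
  intro f hf
  have := (hB.inter_left hcl).eventually_forall_of_forall_eventually (x₀ := f)
    (P := fun g v ↦ g v ≠ 0) fun v hv ↦ hcont.continuousAt.eventually_ne (hf.2 v (hKB hv))
  filter_upwards [this] with g hg
  have hg' : ∀ v ∈ K, g v ≠ 0 := fun v hv h ↦ by
    obtain ⟨c, hc, hcv⟩ := hBs v (fun h ↦ h0 (h ▸ hv))
    exact hg _ ⟨Or.inr (hK v hv c hc.ne'), hcv⟩ (by simp [h])
  refine ⟨?_, hg'⟩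
  rintro rfl
  exact hg' _ hne.some_mem rfl

end Polar

/-! ### Cones of representatives, segments and hyperplanes. -/

section

variable {W : Type*} [AddCommGroup W] [Module ℝ W]

/-- The nonzero vectors that represent a point of `S`. -/
def coneOf (S : Set (ℙ ℝ W)) : Set W :=
  {v | ∃ h : v ≠ 0, Projectivization.mk ℝ v h ∈ S}

theorem zero_notMem_coneOf (S : Set (ℙ ℝ W)) : (0 : W) ∉ coneOf S := fun h ↦ h.1 rfl

theorem mk_mem_iff {S : Set (ℙ ℝ W)} {v : W} (h : v ≠ 0) :
    Projectivization.mk ℝ v h ∈ S ↔ v ∈ coneOf S :=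
  ⟨fun h' ↦ ⟨h, h'⟩, fun h' ↦ h'.2⟩

theorem mk_smul_eq {v : W} (h : v ≠ 0) {c : ℝ} (h' : c • v ≠ 0) :
    Projectivization.mk ℝ (c • v) h' = Projectivization.mk ℝ v h :=
  (Projectivization.mk_eq_mk_iff' ℝ _ _ _ _).2 ⟨c, rfl⟩

theorem smul_mem_coneOf {S : Set (ℙ ℝ W)} {v : W} (hv : v ∈ coneOf S) {c : ℝ} (hc : c ≠ 0) :
    c • v ∈ coneOf S := by
  obtain ⟨h, hS⟩ := hv
  exact ⟨smul_ne_zero hc h, by rwa [mk_smul_eq h]⟩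

theorem smul_mem_coneOf_iff {S : Set (ℙ ℝ W)} {v : W} {c : ℝ} (hc : c ≠ 0) :
    c • v ∈ coneOf S ↔ v ∈ coneOf S :=
  ⟨fun h ↦ by simpa [smul_smul, hc] using smul_mem_coneOf h (inv_ne_zero hc),
    fun h ↦ smul_mem_coneOf h hc⟩

theorem coneOf_subset_iff {S T : Set (ℙ ℝ W)} : coneOf S ⊆ coneOf T ↔ S ⊆ T := by
  refine ⟨fun h p hp ↦ ?_, fun h v hv ↦ ⟨hv.1, h hv.2⟩⟩
  induction p using Projectivization.ind with
  | h v hv => exact (h ⟨hv, hp⟩).2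

theorem coneOf_injective : Function.Injective (coneOf : Set (ℙ ℝ W) → Set W) := fun _ _ h ↦
  (coneOf_subset_iff.1 h.le).antisymm (coneOf_subset_iff.1 h.ge)

theorem coneOf_nonempty {S : Set (ℙ ℝ W)} (hS : S.Nonempty) : (coneOf S).Nonempty := by
  obtain ⟨p, hp⟩ := hS
  exact ⟨p.rep, p.rep_nonzero, by rwa [p.mk_rep]⟩

theorem disjoint_hyperplane_mk_iff {S : Set (ℙ ℝ W)} {f : Module.Dual ℝ W} (hf : f ≠ 0) :
    Disjoint (hyperplane (Projectivization.mk ℝ f hf)) S ↔ ∀ v ∈ coneOf S, f v ≠ 0 := by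
  rw [Set.disjoint_right]
  constructor
  · exact fun h v hv h' ↦ h hv.2 ((mk_mem_hyperplane_mk hf hv.1).2 h')
  · intro h p hp
    induction p using Projectivization.ind with
    | h v hv => exact fun h' ↦ h v ⟨hv, hp⟩ ((mk_mem_hyperplane_mk hf hv).1 h')

theorem exists_disjoint_hyperplane_iff {S : Set (ℙ ℝ W)} :
    (∃ q : ℙ ℝ (Module.Dual ℝ W), Disjoint (hyperplane q) S) ↔ (avoiding (coneOf S)).Nonempty := by
  constructor
  · rintro ⟨q, hq⟩
    induction q using Projectivization.ind with
    | h f hf => exact ⟨f, hf, (disjoint_hyperplane_mk_iff hf).1 hq⟩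
  · rintro ⟨f, hf, h⟩
    exact ⟨_, (disjoint_hyperplane_mk_iff hf).2 h⟩

theorem avoiding_anti {K L : Set W} (h : K ⊆ L) : avoiding L ⊆ avoiding K :=
  fun _ hf ↦ ⟨hf.1, fun v hv ↦ hf.2 v (h hv)⟩

theorem segNonneg_subset_iff {S : Set (ℙ ℝ W)} {u v : W} :
    segNonneg u v ⊆ S ↔
      ∀ a b : ℝ, 0 ≤ a → 0 ≤ b → a • u + b • v ≠ 0 → a • u + b • v ∈ coneOf S := by
  constructor
  · exact fun h a b ha hb h0 ↦ ⟨h0, h ⟨a, b, h0, mul_nonneg ha hb, rfl⟩⟩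
  · rintro h _ ⟨a, b, h0, hab, rfl⟩
    rw [mk_mem_iff]
    rcases mul_nonneg_iff.1 hab with ⟨ha, hb⟩ | ⟨ha, hb⟩
    · exact h a b ha hb h0
    · rw [← smul_mem_coneOf_iff (neg_ne_zero.2 one_ne_zero)]
      have e : (-1 : ℝ) • (a • u + b • v) = (-a) • u + (-b) • v := by module
      rw [e]
      refine h _ _ (by linarith) (by linarith) ?_
      rw [← e]
      exact smul_ne_zero (by norm_num) h0

theorem segNonpos_eq (u v : W) : segNonpos u v = segNonneg u (-v) := by
  ext x
  constructor
  · rintro ⟨a, b, h, hab, rfl⟩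
    exact ⟨a, -b, by simpa using h, by linarith, by simp⟩
  · rintro ⟨a, b, h, hab, rfl⟩
    exact ⟨a, -b, by simpa using h, by linarith, by simp⟩

/-- A set is semiconvex if any two of its points have representatives whose nonnegative
combinations represent points of the set. -/
theorem isSemiconvex_of {S : Set (ℙ ℝ W)}
    (h : ∀ u ∈ coneOf S, ∀ v ∈ coneOf S, ∃ c d : ℝ, c ≠ 0 ∧ d ≠ 0 ∧
      segNonneg (c • u) (d • v) ⊆ S) : IsSemiconvex S := by
  intro p hp q hq hpq
  induction p using Projectivization.ind with | h u hu => ?_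
  induction q using Projectivization.ind with | h v hv => ?_
  obtain ⟨c, d, hc, hd, hS⟩ := h u ⟨hu, hp⟩ v ⟨hv, hq⟩
  exact ⟨_, ⟨hpq, c • u, d • v, smul_ne_zero hc hu, smul_ne_zero hd hv, mk_smul_eq _ _,
    mk_smul_eq _ _, Or.inl rfl⟩, hS⟩

theorem segNonneg_smul_subset {u v : W} {a b : ℝ} (hab : 0 < a * b) :
    segNonneg u v ⊆ segNonneg (a • u) (b • v) := by
  have ha : a ≠ 0 := left_ne_zero_of_mul hab.ne'
  have hb : b ≠ 0 := right_ne_zero_of_mul hab.ne'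
  rintro _ ⟨s, t, h, hst, rfl⟩
  refine ⟨s / a, t / b, by simpa [smul_smul, ha, hb] using h, ?_, ?_⟩
  · rw [div_mul_div_comm]
    positivity
  · simp [smul_smul, ha, hb]

theorem segNonneg_subset_of_eq_smul {S : Set (ℙ ℝ W)} {u v : W} (hv : v ∈ coneOf S) {c : ℝ}
    (h : u = c • v) : segNonneg u v ⊆ S := by
  rw [segNonneg_subset_iff]
  intro a b _ _ h0
  subst h
  have e : a • c • v + b • v = (a * c + b) • v := by module
  rw [e] at h0 ⊢
  exact smul_mem_coneOf hv (left_ne_zero_of_smul h0)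

/-- The segment supplied by semiconvexity comes with its own representatives; passing to `u` and `v`
swaps the two segments exactly when the product of the scaling factors is negative. -/
theorem IsSemiconvex.segNonneg_subset_or {S : Set (ℙ ℝ W)} (hS : IsSemiconvex S) {u v : W}
    (hu : u ∈ coneOf S) (hv : v ∈ coneOf S) :
    segNonneg u v ⊆ S ∨ segNonneg u (-v) ⊆ S := by
  by_cases hpq : Projectivization.mk ℝ u hu.1 = Projectivization.mk ℝ v hv.1
  · obtain ⟨c, hc⟩ := (Projectivization.mk_eq_mk_iff' ℝ _ _ _ _).1 hpq
    exact Or.inl (segNonneg_subset_of_eq_smul hv hc.symm)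
  · obtain ⟨T, ⟨-, u', v', hu', hv', hu1, hv1, hT⟩, hTS⟩ := hS _ hu.2 _ hv.2 hpq
    obtain ⟨a, rfl⟩ := (Projectivization.mk_eq_mk_iff' ℝ _ _ _ _).1 hu1
    obtain ⟨b, rfl⟩ := (Projectivization.mk_eq_mk_iff' ℝ _ _ _ _).1 hv1
    have ha : a ≠ 0 := left_ne_zero_of_smul hu'
    have hb : b ≠ 0 := left_ne_zero_of_smul hv'
    rcases lt_or_gt_of_ne (mul_ne_zero ha hb) with hab | hab
    · have e : b • v = (-b) • -v := by simp
      rcases hT with rfl | rfl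
      · right
        rw [e] at hTS
        exact (segNonneg_smul_subset (by linarith)).trans hTS
      · left
        rw [segNonpos_eq, ← neg_smul] at hTS
        exact (segNonneg_smul_subset (by linarith)).trans hTS
    · rcases hT with rfl | rfl
      · exact Or.inl ((segNonneg_smul_subset hab).trans hTS)
      · right
        rw [segNonpos_eq, ← smul_neg] at hTS
        exact (segNonneg_smul_subset hab).trans hTS

/-- Of the two segments between two points, a semiconvex set contains the one that misses a
hyperplane disjoint from the set. -/
theorem IsSemiconvex.segNonneg_subset {S : Set (ℙ ℝ W)} (hS : IsSemiconvex S)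
    {f : Module.Dual ℝ W} (hf : ∀ v ∈ coneOf S, f v ≠ 0) {u v : W}
    (hu : u ∈ coneOf S) (hv : v ∈ coneOf S) (huv : 0 < f u * f v) : segNonneg u v ⊆ S := by
  rcases hS.segNonneg_subset_or hu hv with h | h
  · exact h
  -- This zero of `f` lies on the other segment unless it is the zero vector, in which case `u` and
  -- `v` are proportional.
  by_cases h0 : f v • u + f u • -v = 0
  · refine segNonneg_subset_of_eq_smul hv (c := (f v)⁻¹ * f u) ?_
    have h1 : f v • u = f u • v := by
      rwa [smul_neg, ← sub_eq_add_neg, sub_eq_zero] at h0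
    rw [mul_smul, ← h1, smul_smul, inv_mul_cancel₀ (hf v hv), one_smul]
  · have hm : f v • u + f u • -v ∈ coneOf S :=
      (mk_mem_iff h0).1 (h ⟨f v, f u, h0, by linarith, rfl⟩)
    exact absurd (by simp [mul_comm]) (hf _ hm)

theorem IsSemiconvex.convex {S : Set (ℙ ℝ W)} (hS : IsSemiconvex S)
    {f : Module.Dual ℝ W} (hf : ∀ v ∈ coneOf S, f v ≠ 0) :
    Convex ℝ (coneOf S ∩ {v | 0 < f v}) := by
  rintro u ⟨hu, hfu⟩ v ⟨hv, hfv⟩ a b ha hb hab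
  have hpos : a • u + b • v ∈ {v | 0 < f v} :=
    convex_halfSpace_gt f.isLinear 0 hfu hfv ha hb hab
  refine ⟨?_, hpos⟩
  refine segNonneg_subset_iff.1 (hS.segNonneg_subset hf hu hv (mul_pos hfu hfv)) a b ha hb ?_
  intro h
  rw [h] at hpos
  simp at hpos

/-- Two hyperplanes disjoint from a semiconvex set do not separate its points. -/
theorem IsSemiconvex.mul_pos_of_mul_pos {S : Set (ℙ ℝ W)} (hS : IsSemiconvex S)
    {f g : Module.Dual ℝ W} (hf : ∀ v ∈ coneOf S, f v ≠ 0) (hg : ∀ v ∈ coneOf S, g v ≠ 0)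
    {u v : W} (hu : u ∈ coneOf S) (hv : v ∈ coneOf S) (huv : 0 < f u * f v) : 0 < g u * g v := by
  by_contra! hneg
  have hlt : g u * g v < 0 := lt_of_le_of_ne hneg (mul_ne_zero (hg u hu) (hg v hv))
  have h := hS.segNonneg_subset hf hu hv huv
  -- As `g u` and `g v` have opposite signs, this zero of `g` would be a point of the segment inside
  -- `S`; if it is the zero vector, applying `f` gives a sign contradiction.
  by_cases h0 : g v • u + (-g u) • v = 0
  · have h1 : g v * f u + -g u * f v = 0 := by simpa using congrArg f h0
    have h2 : g v * f u = g u * f v := by linarith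
    have h3 : (g u * g v) * (f u * f v) = (g u * f v) ^ 2 := by
      calc (g u * g v) * (f u * f v) = (g v * f u) * (g u * f v) := by ring
        _ = _ := by rw [h2]; ring
    have h4 := mul_neg_of_neg_of_pos hlt huv
    have h5 := sq_nonneg (g u * f v)
    linarith
  · have hm : g v • u + (-g u) • v ∈ coneOf S :=
      (mk_mem_iff h0).1 (h ⟨g v, -g u, h0, by linarith, rfl⟩)
    exact absurd (by simp [mul_comm]) (hg _ hm)

theorem isProjConvex_delta (q : ℙ ℝ (Module.Dual ℝ W)) : IsProjConvex (delta q) := by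
  refine ⟨?_, q, disjoint_compl_right⟩
  induction q using Projectivization.ind with | h f hf => ?_
  have hmem : ∀ v, v ∈ coneOf (delta (Projectivization.mk ℝ f hf)) ↔ f v ≠ 0 := by
    intro v
    constructor
    · rintro ⟨h, h'⟩ h0
      exact h' ((mk_mem_hyperplane_mk hf h).2 h0)
    · intro h
      have hv : v ≠ 0 := by
        rintro rfl
        simp at h
      exact ⟨hv, fun h' ↦ h ((mk_mem_hyperplane_mk hf hv).1 h')⟩
  refine isSemiconvex_of fun u hu v hv ↦ ?_
  rw [hmem] at hu hv
  refine ⟨(f u)⁻¹, (f v)⁻¹, inv_ne_zero hu, inv_ne_zero hv, segNonneg_subset_iff.2 ?_⟩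
  intro a b ha hb h0
  rw [hmem]
  simp only [map_add, map_smul, smul_eq_mul, inv_mul_cancel₀ hu, inv_mul_cancel₀ hv, mul_one]
  intro hab
  obtain ⟨rfl, rfl⟩ : a = 0 ∧ b = 0 := ⟨by linarith, by linarith⟩
  simp at h0

theorem eq_of_hyperplane_subset {q r : ℙ ℝ (Module.Dual ℝ W)} (h : hyperplane q ⊆ hyperplane r) :
    q = r := by
  induction q using Projectivization.ind with | h f hf => ?_
  induction r using Projectivization.ind with | h g hg => ?_
  have hk : LinearMap.ker f ≤ LinearMap.ker g := by
    intro v hv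
    by_cases h0 : v = 0
    · simp [h0]
    · exact (mk_mem_hyperplane_mk hg h0).1 (h ((mk_mem_hyperplane_mk hf h0).2 hv))
  obtain ⟨w, hw⟩ : ∃ w, f w ≠ 0 := by
    by_contra! h
    exact hf (LinearMap.ext h)
  refine ((Projectivization.mk_eq_mk_iff' ℝ _ _ _ _).2 ⟨g w / f w, ?_⟩).symm
  ext v
  have : v - (f v / f w) • w ∈ LinearMap.ker f := by simp [div_mul_cancel₀ _ hw]
  have h2 : g v - f v / f w * g w = 0 := by simpa using hk this
  simp only [LinearMap.smul_apply, smul_eq_mul]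
  rw [sub_eq_zero] at h2
  rw [h2]
  ring

/-- Complements of hyperplanes are maximal convex sets, hence irreducible. -/
theorem isIrreducibleConvex_delta (q : ℙ ℝ (Module.Dual ℝ W)) :
    IsIrreducibleConvex (delta q) := by
  refine ⟨isProjConvex_delta q, fun B C hB _ h ↦ Or.inl ?_⟩
  have hsub : delta q ⊆ B := h.le.trans Set.inter_subset_left
  obtain ⟨-, r, hr⟩ := hB
  have hrq : hyperplane r ⊆ hyperplane q :=
    Set.compl_subset_compl.1 (hsub.trans hr.subset_compl_left)
  obtain rfl := eq_of_hyperplane_subset hrq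
  exact hsub.antisymm hr.subset_compl_left

/-- The irreducibility clause in `Phi` holds for every hyperplane complement, so only disjointness
from the hyperplane remains. -/
theorem coneOf_Phi (S : Set (ℙ ℝ W)) : coneOf (Phi S) = avoiding (coneOf S) := by
  have key : ∀ q, q ∈ Phi S ↔ Disjoint (hyperplane q) S := by
    intro q
    rw [← Set.subset_compl_iff_disjoint_left]
    constructor
    · rintro ⟨A, -, hS, rfl⟩
      exact hS
    · exact fun h ↦ ⟨_, isIrreducibleConvex_delta q, h, rfl⟩
  ext f
  constructor
  · rintro ⟨hf, h⟩
    exact ⟨hf, (disjoint_hyperplane_mk_iff hf).1 ((key _).1 h)⟩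
  · rintro ⟨hf, h⟩
    exact ⟨hf, (key _).2 ((disjoint_hyperplane_mk_iff hf).2 h)⟩

theorem isProjConvex_iff {S : Set (ℙ ℝ W)} :
    IsProjConvex S ↔ IsSemiconvex S ∧ (avoiding (coneOf S)).Nonempty :=
  and_congr_right fun _ ↦ exists_disjoint_hyperplane_iff

end

/-! ### Hulls as co-components, sign classes as components. -/

section

variable {W : Type*} [AddCommGroup W] [Module ℝ W]

/-- The points of the projective space represented by the nonzero vectors of `K`. -/
def proj (K : Set W) : Set (ℙ ℝ W) :=
  {p | ∃ v ∈ K, ∃ h : v ≠ 0, Projectivization.mk ℝ v h = p}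

theorem mem_coneOf_proj {K : Set W} {v : W} :
    v ∈ coneOf (proj K) ↔ v ≠ 0 ∧ ∃ c : ℝ, c ≠ 0 ∧ c • v ∈ K := by
  constructor
  · rintro ⟨h, w, hw, h0, e⟩
    obtain ⟨c, rfl⟩ := (Projectivization.mk_eq_mk_iff' ℝ _ _ _ _).1 e
    exact ⟨h, c, left_ne_zero_of_smul h0, hw⟩
  · rintro ⟨h, c, hc, hK⟩
    exact ⟨h, _, hK, smul_ne_zero hc h, mk_smul_eq h _⟩

theorem isSemiconvex_proj {K : Set W} (hK : Convex ℝ K) : IsSemiconvex (proj K) := by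
  refine isSemiconvex_of fun u hu v hv ↦ ?_
  obtain ⟨hu0, c, hc, hcu⟩ := mem_coneOf_proj.1 hu
  obtain ⟨hv0, d, hd, hdv⟩ := mem_coneOf_proj.1 hv
  refine ⟨c, d, hc, hd, segNonneg_subset_iff.2 fun a b ha hb h0 ↦ ?_⟩
  have hab : 0 < a + b := by
    rcases (add_nonneg ha hb).lt_or_eq with h | h
    · exact h
    · obtain ⟨rfl, rfl⟩ : a = 0 ∧ b = 0 := ⟨by linarith, by linarith⟩
      simp at h0
  refine mem_coneOf_proj.2 ⟨h0, (a + b)⁻¹, by positivity, ?_⟩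
  convert hK hcu hdv (mul_nonneg (inv_nonneg.2 hab.le) ha) (mul_nonneg (inv_nonneg.2 hab.le) hb)
    (by rw [← mul_add, inv_mul_cancel₀ hab.ne']) using 1
  module

theorem proj_subset {K : Set W} {S : Set (ℙ ℝ W)} (h : K ⊆ coneOf S) : proj K ⊆ S := by
  rintro _ ⟨v, hv, h0, rfl⟩
  exact (mk_mem_iff h0).2 (h hv)

/-- The convex hull of `D` in the affine chart that is the complement of the hyperplane `f = 0`. -/
def hull (f : Module.Dual ℝ W) (D : Set (ℙ ℝ W)) : Set (ℙ ℝ W) :=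
  proj (convexHull ℝ (coneOf D ∩ {v | 0 < f v}))

theorem pos_of_mem_convexHull {K : Set W} {f : Module.Dual ℝ W} (h : ∀ v ∈ K, 0 < f v) :
    ∀ v ∈ convexHull ℝ K, 0 < f v :=
  convexHull_min h (convex_halfSpace_gt f.isLinear 0)

theorem ne_zero_of_mem_coneOf_proj {K : Set W} {f : Module.Dual ℝ W} (h : ∀ v ∈ K, f v ≠ 0) :
    ∀ v ∈ coneOf (proj K), f v ≠ 0 := by
  intro v hv h0
  obtain ⟨-, c, -, hcv⟩ := mem_coneOf_proj.1 hv
  exact h _ hcv (by simp [h0])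

theorem avoiding_hull {f : Module.Dual ℝ W} {D : Set (ℙ ℝ W)} :
    ∀ v ∈ coneOf (hull f D), f v ≠ 0 :=
  ne_zero_of_mem_coneOf_proj fun v hv ↦ (pos_of_mem_convexHull (fun _ h ↦ h.2) v hv).ne'

theorem subset_hull {f : Module.Dual ℝ W} {D : Set (ℙ ℝ W)} (hf : ∀ v ∈ coneOf D, f v ≠ 0) :
    D ⊆ hull f D := by
  rw [← coneOf_subset_iff]
  intro v hv
  refine mem_coneOf_proj.2 ⟨hv.1, f v, hf v hv, subset_convexHull ℝ _ ⟨?_, ?_⟩⟩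
  · exact smul_mem_coneOf hv (hf v hv)
  · simpa using hf v hv

theorem hull_subset {f : Module.Dual ℝ W} {D M : Set (ℙ ℝ W)} (hM : IsSemiconvex M)
    (hf : ∀ v ∈ coneOf M, f v ≠ 0) (hDM : D ⊆ M) : hull f D ⊆ M := by
  refine proj_subset fun v hv ↦ ?_
  exact (convexHull_min (Set.inter_subset_inter_left _ (coneOf_subset_iff.2 hDM))
    (hM.convex hf) hv).1

theorem isProjConvex_hull {f : Module.Dual ℝ W} (hf : f ≠ 0) {D : Set (ℙ ℝ W)} :
    IsProjConvex (hull f D) :=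
  isProjConvex_iff.2 ⟨isSemiconvex_proj (convex_convexHull ℝ _), f, hf, avoiding_hull⟩

/-- The co-components of `D` are its hulls in the affine charts that contain it. -/
theorem hull_mem_cocomp {f : Module.Dual ℝ W} {D : Set (ℙ ℝ W)} (hf : f ∈ avoiding (coneOf D)) :
    hull f D ∈ cocomp D := by
  refine ⟨⟨isProjConvex_hull hf.1, subset_hull hf.2⟩, fun M ⟨hM, hDM⟩ hMh ↦ ?_⟩
  exact hull_subset hM.1 (fun v hv ↦ avoiding_hull v (coneOf_subset_iff.2 hMh hv)) hDM

/-- The hull lies between `D` and `M`, so minimality forces equality. Thus any single functional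
avoiding a co-component determines it, which later gives injectivity. -/
theorem eq_hull_of_mem_cocomp {D M : Set (ℙ ℝ W)} (hM : M ∈ cocomp D) {f : Module.Dual ℝ W}
    (hf : f ∈ avoiding (coneOf M)) : M = hull f D := by
  have hDM := hM.1.2
  have h := hull_subset hM.1.1.1 hf.2 hDM
  have hfD := avoiding_anti (coneOf_subset_iff.2 hDM) hf
  exact (hM.2 ⟨isProjConvex_hull hf.1, subset_hull hfD.2⟩ h).antisymm h

/-- The representatives of points of `D` at which all functionals in `A` have the same sign as
at `u`. -/
def signCone (A : Set (Module.Dual ℝ W)) (D : Set (ℙ ℝ W)) (u : W) : Set W :=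
  {w | w ∈ coneOf D ∧ ∀ φ ∈ A, 0 < φ u * φ w}

section Components

variable {A : Set (Module.Dual ℝ W)} {D : Set (ℙ ℝ W)}

theorem self_mem_signCone (hav : A ⊆ avoiding (coneOf D)) {u : W} (hu : u ∈ coneOf D) :
    u ∈ signCone A D u :=
  ⟨hu, fun _ hφ ↦ mul_self_pos.2 ((hav hφ).2 u hu)⟩

theorem mem_coneOf_proj_self {K : Set W} {v : W} (hv : v ∈ K) (h0 : v ≠ 0) :
    v ∈ coneOf (proj K) :=
  mem_coneOf_proj.2 ⟨h0, 1, one_ne_zero, by simpa using hv⟩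

theorem proj_signCone_subset (u : W) : proj (signCone A D u) ⊆ D :=
  proj_subset fun _ h ↦ h.1

/-- A convex subset of `D` lies in a single sign class. -/
theorem subset_proj_signCone (hA : A.Nonempty) (hav : A ⊆ avoiding (coneOf D))
    {M : Set (ℙ ℝ W)} (hM : IsSemiconvex M) (hMD : M ⊆ D) {u : W} (hu : u ∈ coneOf M) :
    M ⊆ proj (signCone A D u) := by
  rw [← coneOf_subset_iff] at hMD ⊢
  intro w hw
  obtain ⟨φ, hφ⟩ := hA
  have hne : φ u * φ w ≠ 0 :=
    mul_ne_zero ((hav hφ).2 u (hMD hu)) ((hav hφ).2 w (hMD hw))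
  have hw' := smul_mem_coneOf hw hne
  -- The factor `φ u * φ w` makes `φ` agree in sign at `u` and at the rescaled `w`; semiconvexity of
  -- `M` carries this agreement to every `ψ`.
  refine mem_coneOf_proj.2 ⟨hw.1, φ u * φ w, hne, hMD hw', fun ψ hψ ↦ ?_⟩
  refine hM.mul_pos_of_mul_pos (fun v hv ↦ (hav hφ).2 v (hMD hv))
    (fun v hv ↦ (hav hψ).2 v (hMD hv)) hu hw' ?_
  rw [map_smul, smul_eq_mul, mul_left_comm]
  exact mul_self_pos.2 hne

theorem isProjConvex_proj_signCone (hA : A.Nonempty) (hav : A ⊆ avoiding (coneOf D)) {u : W}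
    (hconv : Convex ℝ (signCone A D u)) : IsProjConvex (proj (signCone A D u)) := by
  obtain ⟨φ, hφ⟩ := hA
  exact isProjConvex_iff.2 ⟨isSemiconvex_proj hconv, φ, (hav hφ).1,
    ne_zero_of_mem_coneOf_proj fun v hv ↦ (hav hφ).2 v hv.1⟩

/-- A convex subset of `D` containing this class contains the point of `u`, so it lies in the sign
class of `u`. -/
theorem proj_signCone_mem_comp (hA : A.Nonempty) (hav : A ⊆ avoiding (coneOf D)) {u : W}
    (hu : u ∈ coneOf D) (hconv : Convex ℝ (signCone A D u)) :
    proj (signCone A D u) ∈ comp D := by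
  refine ⟨⟨isProjConvex_proj_signCone hA hav hconv, proj_signCone_subset u⟩, ?_⟩
  rintro M ⟨hM, hMD⟩ hle
  exact subset_proj_signCone hA hav hM.1 hMD
    (coneOf_subset_iff.2 hle (mem_coneOf_proj_self (self_mem_signCone hav hu) hu.1))

theorem eq_of_mem_comp (hA : A.Nonempty) (hav : A ⊆ avoiding (coneOf D)) {N : Set (ℙ ℝ W)}
    (hN : N ∈ comp D) {u : W} (hu : u ∈ coneOf N) (hconv : Convex ℝ (signCone A D u)) :
    N = proj (signCone A D u) := by
  have h := subset_proj_signCone hA hav hN.1.1.1 hN.1.2 hu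
  exact h.antisymm
    (hN.2 ⟨isProjConvex_proj_signCone hA hav hconv, proj_signCone_subset u⟩ h)

/-- The empty set is not maximal, since a sign class is a larger convex subset. -/
theorem nonempty_of_mem_comp (hA : A.Nonempty) (hav : A ⊆ avoiding (coneOf D)) (hD : D.Nonempty)
    (hconv : ∀ u ∈ coneOf D, Convex ℝ (signCone A D u)) {N : Set (ℙ ℝ W)} (hN : N ∈ comp D) :
    (coneOf N).Nonempty := by
  obtain ⟨u, hu⟩ := coneOf_nonempty hD
  by_contra h
  have hNe : N = ∅ := by
    by_contra hne
    exact h (coneOf_nonempty (Set.nonempty_iff_ne_empty.2 hne))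
  have := (proj_signCone_mem_comp hA hav hu (hconv u hu)).1
  have := coneOf_subset_iff.2 (hN.2 this (hNe ▸ Set.empty_subset _))
  exact h ⟨u, this (mem_coneOf_proj_self (self_mem_signCone hav hu) hu.1)⟩

end Components

end

/-! ### Separation in projective space. -/

section Topology

variable {W : Type*} [AddCommGroup W] [Module ℝ W] [TopologicalSpace W]

theorem isOpen_coneOf [T1Space W] {S : Set (ℙ ℝ W)} (hS : IsOpen S) : IsOpen (coneOf S) := by
  have hc : Continuous (Projectivization.mk' ℝ : {v : W // v ≠ 0} → ℙ ℝ W) :=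
    continuous_quotient_mk'
  have h := isOpen_compl_singleton.isOpenMap_subtype_val _ (hS.preimage hc)
  convert h using 1
  ext v
  constructor
  · rintro ⟨h0, hv⟩
    exact ⟨⟨v, h0⟩, hv, rfl⟩
  · rintro ⟨w, hw, rfl⟩
    exact ⟨w.2, hw⟩

theorem isClosed_insert_zero_coneOf [T1Space W] {S : Set (ℙ ℝ W)} (hS : IsClosed S) :
    IsClosed (insert 0 (coneOf S)) := by
  rw [← isOpen_compl_iff]
  convert isOpen_coneOf hS.isOpen_compl using 1
  ext v
  simp only [coneOf, Set.mem_compl_iff, Set.mem_insert_iff, Set.mem_ofPred_eq, not_or, not_exists]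
  exact ⟨fun h ↦ ⟨h.1, h.2 h.1⟩, fun h ↦ ⟨h.1, fun _ ↦ h.2⟩⟩

variable [FiniteDimensional ℝ W] [IsTopologicalAddGroup W] [ContinuousSMul ℝ W] [T2Space W]

/-- A point outside a hull lies on a hyperplane that misses the hull. -/
theorem exists_dual_pos_of_notMem_hull {D : Set (ℙ ℝ W)}
    (htop : IsOpen (coneOf D) ∨ IsClosed (insert 0 (coneOf D))) {f : Module.Dual ℝ W}
    (hf : ∀ v ∈ coneOf D, f v ≠ 0) {p : W} (hp : p ≠ 0) (hpD : p ∉ coneOf (hull f D)) :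
    ∃ g : Module.Dual ℝ W, g p = 0 ∧ ∀ v ∈ coneOf D, 0 < f v → 0 < g v := by
  refine exists_dual_pos (fun v hv c hc ↦ smul_mem_coneOf hv hc) (zero_notMem_coneOf D) htop hf ?_
  intro c hc
  refine hpD (mem_coneOf_proj.2 ⟨hp, c, ?_, hc⟩)
  rintro rfl
  simpa using pos_of_mem_convexHull (f := f) (fun _ h ↦ h.2) _ hc

/-- A multi-convex set that is open or closed is the complement of the union of the hyperplanes
disjoint from it. -/
theorem mem_coneOf_of_forall_avoiding {C : Set (ℙ ℝ W)} (hC : IsMultiConvex C) (hne : C.Nonempty)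
    (htop : IsOpen C ∨ IsClosed C) {p : W} (hp : p ≠ 0)
    (h : ∀ f ∈ avoiding (coneOf C), f p ≠ 0) : p ∈ coneOf C := by
  by_contra hpC
  obtain ⟨F, -, hF, rfl⟩ := hC
  obtain ⟨N, hN, hpN⟩ : ∃ N ∈ F, p ∉ coneOf N := by
    by_contra! hall
    exact hpC ⟨hp, fun N hN ↦ (hall N hN).2⟩
  have hCN := Set.sInter_subset_of_mem hN
  obtain ⟨hNs, f, hf⟩ := isProjConvex_iff.1 (hF N hN)
  have hfC := (avoiding_anti (coneOf_subset_iff.2 hCN) hf).2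
  -- The hull of the intersection in a chart containing `N` stays inside `N`, so it misses `p` and
  -- can be separated from it.
  obtain ⟨g, hgp, hg⟩ := exists_dual_pos_of_notMem_hull
    (htop.imp isOpen_coneOf isClosed_insert_zero_coneOf) hfC hp
    fun h ↦ hpN (coneOf_subset_iff.2 (hull_subset hNs hf.2 hCN) h)
  have hg' : ∀ v ∈ coneOf (⋂₀ F), g v ≠ 0 := by
    intro v hv h0
    have := hg _ (smul_mem_coneOf hv (hfC v hv)) (by simpa using hfC v hv)
    simp [h0] at this
  obtain ⟨v, hv⟩ := coneOf_nonempty hne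
  refine h g ⟨?_, hg'⟩ hgp
  rintro rfl
  exact hg' v hv rfl

end Topology

/-! ### Duality between hulls and sign classes. -/

section Duality

variable {W : Type*} [AddCommGroup W] [Module ℝ W]

theorem IsMultiConvex.avoiding_nonempty {C : Set (ℙ ℝ W)} (hC : IsMultiConvex C) :
    (avoiding (coneOf C)).Nonempty := by
  obtain ⟨F, ⟨N, hN⟩, hF, rfl⟩ := hC
  exact (isProjConvex_iff.1 (hF N hN)).2.mono
    (avoiding_anti (coneOf_subset_iff.2 (Set.sInter_subset_of_mem hN)))

/-- Each `N` in the family is avoided by some `f`, which also avoids `C`. The sign class lies in the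
half of the cone of `N` where `f` has its sign at `u`, and that half is convex. -/
theorem IsMultiConvex.convex_signCone {C : Set (ℙ ℝ W)} (hC : IsMultiConvex C) {u : W}
    (hu : u ∈ coneOf C) : Convex ℝ (signCone (avoiding (coneOf C)) C u) := by
  obtain ⟨F, ⟨N₀, hN₀⟩, hF, rfl⟩ := hC
  intro v hv w hw a b ha hb hab
  have key : ∀ N ∈ F, a • v + b • w ∈ coneOf N := by
    intro N hN
    have hCN := coneOf_subset_iff.2 (Set.sInter_subset_of_mem hN)
    obtain ⟨hNs, f, hf⟩ := isProjConvex_iff.1 (hF N hN)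
    have hf' : ∀ v ∈ coneOf N, (f u • f) v ≠ 0 := fun v hv ↦
      mul_ne_zero (hf.2 u (hCN hu)) (hf.2 v hv)
    have hfC := avoiding_anti hCN hf
    exact (hNs.convex hf' ⟨hCN hv.1, hv.2 f hfC⟩ ⟨hCN hw.1, hw.2 f hfC⟩ ha hb hab).1
  refine ⟨⟨(key N₀ hN₀).1, fun N hN ↦ (key N hN).2⟩, fun φ hφ ↦ ?_⟩
  exact convex_halfSpace_gt (φ u • φ).isLinear 0 (hv.2 φ hφ) (hw.2 φ hφ) ha hb hab

theorem eval_ne_zero [FiniteDimensional ℝ W] {v : W} (hv : v ≠ 0) : Module.Dual.eval ℝ W v ≠ 0 := fun h ↦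
  hv ((Module.forall_dual_apply_eq_zero_iff ℝ v).1 fun f ↦ LinearMap.congr_fun h f)

theorem eval_image_subset_avoiding [FiniteDimensional ℝ W] (C : Set (ℙ ℝ W)) :
    Module.Dual.eval ℝ W '' coneOf C ⊆ avoiding (coneOf (Phi C)) := by
  rintro _ ⟨v, hv, rfl⟩
  refine ⟨eval_ne_zero hv.1, fun f hf ↦ ?_⟩
  rw [coneOf_Phi] at hf
  exact hf.2 v hv

/-- The strict sign conditions already force `g` to avoid `C`, so the class is an intersection of
half-spaces. -/
theorem convex_signCone_Phi {C : Set (ℙ ℝ W)} (hne : C.Nonempty) (f : Module.Dual ℝ W) :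
    Convex ℝ (signCone (Module.Dual.eval ℝ W '' coneOf C) (Phi C) f) := by
  have e : signCone (Module.Dual.eval ℝ W '' coneOf C) (Phi C) f =
      ⋂ v ∈ coneOf C, {g | 0 < (f v • Module.Dual.eval ℝ W v) g} := by
    ext g
    simp only [signCone, coneOf_Phi, Set.forall_mem_image, Set.mem_iInter, Set.mem_ofPred_eq]
    constructor
    · exact fun h ↦ h.2
    · intro h
      have hg : ∀ v ∈ coneOf C, g v ≠ 0 := fun v hv ↦ right_ne_zero_of_mul (h v hv).ne'
      refine ⟨⟨?_, hg⟩, h⟩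
      rintro rfl
      exact hg _ (coneOf_nonempty hne).some_mem rfl
  rw [e]
  exact convex_iInter₂ fun v _ ↦ convex_halfSpace_gt (LinearMap.isLinear _) 0

/-- The dual of a co-component of `C` is a sign class of `Φ(C)`. -/
theorem Phi_hull {C : Set (ℙ ℝ W)} (hne : C.Nonempty) {f : Module.Dual ℝ W}
    (hf : f ∈ avoiding (coneOf C)) :
    Phi (hull f C) = proj (signCone (Module.Dual.eval ℝ W '' coneOf C) (Phi C) f) := by
  obtain ⟨u, hu⟩ := coneOf_nonempty hne
  have hsub := coneOf_subset_iff.2 (subset_hull hf.2)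
  apply coneOf_injective
  ext g
  rw [coneOf_Phi, mem_coneOf_proj]
  constructor
  · intro hg
    have hgC := avoiding_anti hsub hg
    -- Rescaling `g` by `f u * g u` makes its product with `f` positive at `u`; semiconvexity of the
    -- hull propagates this to all of `C`.
    have hc : f u * g u ≠ 0 := mul_ne_zero (hf.2 u hu) (hgC.2 u hu)
    have hmem : (f u * g u) • g ∈ coneOf (Phi C) := by
      refine smul_mem_coneOf ?_ hc
      rwa [coneOf_Phi]
    refine ⟨hg.1, f u * g u, hc, hmem, ?_⟩
    rintro _ ⟨v, hv, rfl⟩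
    change 0 < f v * (f u * g u * g v)
    have hfuv : f u * f v ≠ 0 := mul_ne_zero (hf.2 u hu) (hf.2 v hv)
    have h := (isProjConvex_hull (D := C) hf.1).1.mul_pos_of_mul_pos avoiding_hull hg.2
      (hsub hu) (hsub (smul_mem_coneOf hv hfuv)) (by
        rw [map_smul, smul_eq_mul, mul_left_comm]
        exact mul_self_pos.2 hfuv)
    rw [map_smul, smul_eq_mul] at h
    linarith
  · rintro ⟨hg0, c, hc, -, hg⟩
    refine ⟨hg0, ?_⟩
    have := ne_zero_of_mem_coneOf_proj (f := c • g) fun v hv ↦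
      (pos_of_mem_convexHull (K := coneOf C ∩ {v | 0 < f v}) (f := c • g)
        (fun v hv ↦ pos_of_mul_pos_right (hg _ ⟨v, hv.1, rfl⟩) hv.2.le) v hv).ne'
    exact fun v hv ↦ right_ne_zero_of_mul (this v hv)

/-- The dual of a component of `C` is a hull of `Φ(C)`. -/
theorem Phi_proj_signCone [FiniteDimensional ℝ W] [TopologicalSpace W]
    [IsTopologicalAddGroup W] [ContinuousSMul ℝ W] [T2Space W] {C : Set (ℙ ℝ W)} (hC : IsMultiConvex C) (hne : C.Nonempty)
    (htop : IsOpen C ∨ IsClosed C) {u : W} (hu : u ∈ coneOf C) :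
    Phi (proj (signCone (avoiding (coneOf C)) C u)) =
      hull (Module.Dual.eval ℝ W u) (Phi C) := by
  have hself := self_mem_signCone (A := avoiding (coneOf C)) subset_rfl hu
  apply Set.Subset.antisymm
  · rw [← coneOf_subset_iff, coneOf_Phi]
    intro g hg
    by_contra hgh
    let := dualTopology W
    have := isTopologicalAddGroup_dual (W := W)
    have := continuousSMul_dual (W := W)
    have := t2Space_dual (W := W)
    -- Polarity exchanges the open case and the closed case.
    have htop' : IsOpen (coneOf (Phi C)) ∨ IsClosed (insert 0 (coneOf (Phi C))) := by
      rw [coneOf_Phi]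
      rcases htop with h | h
      · exact Or.inr (isClosed_insert_zero_avoiding (isOpen_coneOf h))
      · exact Or.inl (isOpen_avoiding (coneOf_nonempty hne)
          (fun v hv c hc ↦ smul_mem_coneOf hv hc) (zero_notMem_coneOf C)
          (isClosed_insert_zero_coneOf h))
    obtain ⟨ψ, hψg, hψ⟩ := exists_dual_pos_of_notMem_hull htop'
      (eval_image_subset_avoiding C ⟨u, hu, rfl⟩).2 hg.1 hgh
    -- By reflexivity the separating functional is evaluation at some `p`. It has the sign of
    -- evaluation at `u` on all functionals avoiding `C`, so `p` lies in `C` and in the sign class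
    -- of `u`; but `g p = 0`.
    obtain ⟨p, rfl⟩ := (Module.evalEquiv ℝ W).surjective ψ
    rw [coneOf_Phi] at hψ
    have hψ' : ∀ f ∈ avoiding (coneOf C), 0 < f u * f p := by
      intro f hf
      have hfu := hf.2 u hu
      have h : f u • f ∈ avoiding (coneOf C) :=
        ⟨smul_ne_zero hfu hf.1, fun v hv ↦ mul_ne_zero hfu (hf.2 v hv)⟩
      exact hψ _ h (mul_self_pos.2 hfu)
    have hp : p ≠ 0 := by
      rintro rfl
      obtain ⟨f, hf⟩ := hC.avoiding_nonempty
      simpa using hψ' f hf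
    have hpC := mem_coneOf_of_forall_avoiding hC hne htop hp
      fun f hf ↦ right_ne_zero_of_mul (hψ' f hf).ne'
    exact hg.2 p (mem_coneOf_proj_self ⟨hpC, hψ'⟩ hp) hψg
  · refine proj_subset fun g hg ↦ ?_
    rw [coneOf_Phi]
    have hpos : ∀ v ∈ signCone (avoiding (coneOf C)) C u, 0 < g v := fun v hv ↦ by
      refine pos_of_mem_convexHull (f := Module.Dual.eval ℝ W v) ?_ g hg
      rintro f ⟨hf, hfu⟩
      rw [coneOf_Phi] at hf
      exact pos_of_mul_pos_right (hv.2 f hf) (le_of_lt hfu)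
    refine ⟨?_, ne_zero_of_mem_coneOf_proj fun v hv ↦ (hpos v hv).ne'⟩
    rintro rfl
    simpa using hpos u hself

end Duality

/-! ### The two bijections. -/

theorem bijOn_cocomp {W : Type*} [AddCommGroup W] [Module ℝ W] [FiniteDimensional ℝ W]
    {C : Set (ℙ ℝ W)} (hne : C.Nonempty) (hav : (avoiding (coneOf C)).Nonempty) :
    Set.BijOn Phi (cocomp C) (comp (Phi C)) := by
  have hA := (coneOf_nonempty hne).image (Module.Dual.eval ℝ W)
  have hA' := eval_image_subset_avoiding C
  have hP : (Phi C).Nonempty := by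
    obtain ⟨f, hf⟩ := hav
    rw [← coneOf_Phi] at hf
    exact ⟨_, hf.2⟩
  refine ⟨fun M hM ↦ ?_, fun M hM M' hM' h ↦ ?_, fun N hN ↦ ?_⟩
  · obtain ⟨f, hf⟩ := (isProjConvex_iff.1 hM.1.1).2
    have hfC := avoiding_anti (coneOf_subset_iff.2 hM.1.2) hf
    rw [eq_hull_of_mem_cocomp hM hf, Phi_hull hne hfC]
    rw [← coneOf_Phi] at hfC
    exact proj_signCone_mem_comp hA hA' hfC (convex_signCone_Phi hne f)
  -- Equal duals mean that `M` and `M'` are avoided by the same functionals, so both are the hull in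
  -- one common chart.
  · obtain ⟨f, hf⟩ := (isProjConvex_iff.1 hM.1.1).2
    have hf' := hf
    rw [← coneOf_Phi, h, coneOf_Phi] at hf'
    rw [eq_hull_of_mem_cocomp hM hf, eq_hull_of_mem_cocomp hM' hf']
  · obtain ⟨f, hf⟩ := nonempty_of_mem_comp hA hA' hP (fun f _ ↦ convex_signCone_Phi hne f) hN
    have hfC := coneOf_subset_iff.2 hN.1.2 hf
    rw [coneOf_Phi] at hfC
    refine ⟨hull f C, hull_mem_cocomp hfC, ?_⟩
    rw [Phi_hull hne hfC, eq_of_mem_comp hA hA' hN hf (convex_signCone_Phi hne f)]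

theorem bijOn_comp {W : Type*} [AddCommGroup W] [Module ℝ W] [FiniteDimensional ℝ W]
    [TopologicalSpace W] [IsTopologicalAddGroup W] [ContinuousSMul ℝ W] [T2Space W]
    {C : Set (ℙ ℝ W)} (hC : IsMultiConvex C) (hne : C.Nonempty) (htop : IsOpen C ∨ IsClosed C) :
    Set.BijOn Phi (comp C) (cocomp (Phi C)) := by
  have hA := hC.avoiding_nonempty
  have hstruct : ∀ N ∈ comp C, ∃ u ∈ coneOf C, u ∈ coneOf N ∧
      N = proj (signCone (avoiding (coneOf C)) C u) := by
    intro N hN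
    obtain ⟨u, hu⟩ := nonempty_of_mem_comp hA subset_rfl hne (fun u hu ↦ hC.convex_signCone hu) hN
    have huC := coneOf_subset_iff.2 hN.1.2 hu
    exact ⟨u, huC, hu, eq_of_mem_comp hA subset_rfl hN hu (hC.convex_signCone huC)⟩
  have heval : ∀ u ∈ coneOf C, Module.Dual.eval ℝ W u ∈ avoiding (coneOf (Phi C)) :=
    fun u hu ↦ eval_image_subset_avoiding C ⟨u, hu, rfl⟩
  refine ⟨fun N hN ↦ ?_, fun N hN N' hN' h ↦ ?_, fun M hM ↦ ?_⟩
  · obtain ⟨u, hu, -, rfl⟩ := hstruct N hN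
    rw [Phi_proj_signCone hC hne htop hu]
    exact hull_mem_cocomp (heval u hu)
  · obtain ⟨u, hu, huN, e⟩ := hstruct N hN
    obtain ⟨v, hv, hvN, e'⟩ := hstruct N' hN'
    have hPN : IsSemiconvex (Phi N) := by
      rw [e, Phi_proj_signCone hC hne htop hu]
      exact (isProjConvex_hull (heval u hu).1).1
    have hu' : ∀ f ∈ coneOf (Phi N), Module.Dual.eval ℝ W u f ≠ 0 := fun f hf ↦ by
      rw [coneOf_Phi] at hf
      exact hf.2 u huN
    have hv' : ∀ f ∈ coneOf (Phi N), Module.Dual.eval ℝ W v f ≠ 0 := fun f hf ↦ by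
      rw [h, coneOf_Phi] at hf
      exact hf.2 v hvN
    have hsub : Phi C ⊆ Phi N := by
      rw [← coneOf_subset_iff, coneOf_Phi, coneOf_Phi]
      exact avoiding_anti (coneOf_subset_iff.2 hN.1.2)
    -- Evaluations at `u` and `v` both avoid the semiconvex set `Φ(N) = Φ(N')`, so their relative
    -- sign is constant there, in particular on `Φ(C)`. This says that `u` and `v` define the same
    -- sign class.
    have hvmem : v ∈ coneOf N := by
      rw [e]
      obtain ⟨f, hf⟩ := hA
      have hc : f u * f v ≠ 0 := mul_ne_zero (hf.2 u hu) (hf.2 v hv)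
      refine mem_coneOf_proj.2 ⟨hv.1, f u * f v, hc, smul_mem_coneOf hv hc, fun g hg ↦ ?_⟩
      have hfu : f u * g u ≠ 0 := mul_ne_zero (hf.2 u hu) (hg.2 u hu)
      rw [← coneOf_Phi] at hf hg
      have := hPN.mul_pos_of_mul_pos hu' hv' (coneOf_subset_iff.2 hsub hf)
        (smul_mem_coneOf (coneOf_subset_iff.2 hsub hg) hfu) (by
          change 0 < f u * (f u * g u * g u)
          have : 0 < (f u * g u) * (f u * g u) := mul_self_pos.2 hfu
          linarith)
      change 0 < f v * (f u * g u * g v) at this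
      rw [map_smul, smul_eq_mul]
      linarith
    rw [e', ← eq_of_mem_comp hA subset_rfl hN hvmem (hC.convex_signCone hv)]
  · obtain ⟨ψ, hψ⟩ := (isProjConvex_iff.1 hM.1.1).2
    obtain ⟨u, rfl⟩ := (Module.evalEquiv ℝ W).surjective ψ
    have hψC := avoiding_anti (coneOf_subset_iff.2 hM.1.2) hψ
    have hu0 : u ≠ 0 := by
      rintro rfl
      exact hψ.1 (map_zero _)
    -- The evaluation that avoids `M` avoids `Φ(C)`, so no hyperplane missing `C` passes through the
    -- point of `u`.
    have hu : u ∈ coneOf C := mem_coneOf_of_forall_avoiding hC hne htop hu0 fun f hf ↦ by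
      rw [← coneOf_Phi] at hf
      exact hψC.2 f hf
    refine ⟨_, proj_signCone_mem_comp hA subset_rfl hu (hC.convex_signCone hu), ?_⟩
    rw [Phi_proj_signCone hC hne htop hu, eq_hull_of_mem_cocomp hM hψ]
    rfl

end MultiConvex

theorem mainTheorem7 {V : Type*} [AddCommGroup V] [Module ℝ V] [FiniteDimensional ℝ V]
    [TopologicalSpace V] [IsTopologicalAddGroup V] [ContinuousSMul ℝ V] [T2Space V]
    (C : Set (ℙ ℝ V)) (hC : MultiConvex.IsMultiConvex C) (hne : C.Nonempty)
    (htop : IsOpen C ∨ IsClosed C) :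
    Set.BijOn MultiConvex.Phi (MultiConvex.comp C) (MultiConvex.cocomp (MultiConvex.Phi C)) ∧
      Set.BijOn MultiConvex.Phi (MultiConvex.cocomp C) (MultiConvex.comp (MultiConvex.Phi C)) :=
  ⟨MultiConvex.bijOn_comp hC hne htop, MultiConvex.bijOn_cocomp hne hC.avoiding_nonempty⟩
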